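/- Let $\mathcal H$ be a separable complex Hilbert space, let $\mathcal B(\mathcal H)$ be the bounded linear operators on $\mathcal H$ and $\Phi(\mathcal H)$ the set of bounded Fredholm operators, that is, of those $T\in\mathcal B(\mathcal H)$ for which $\operatorname{ran}T$ is closed and $\ker T$, $\ker T^*$ are finite-dimensional. Write $\operatorname{ind}(T)=\dim\ker T-\dim\ker T^*$ for $T\in\Phi(\mathcal H)$ and $\operatorname{def}(T)=\dim\big((\operatorname{ran}T)^{\perp}\big)$. Let $\mathcal F(\mathcal H)$ be the finite rank operators, $\mathcal B_\infty(\mathcal H)$ the compact operators and $\mathcal B_p(\mathcal H)$, $1\le p<\infty$, the Schatten--von Neumann ideals. Let $\Omega\subseteq\mathbb C$ be open and connected, let $A:\Omega\to\mathcal B(\mathcal H)$ be analytic with $A(z)\in\Phi(\mathcal H)$ for all $z\in\Omega$, and let $z_0\in\Omega$ be a pole of $A(\cdot)^{-1}$, of order $n_0\in\mathbb N=\{1,2,\dots\}$. (In particular, $A(z)$ is boundedly invertible for all $z\ne z_0$ sufficiently close to $z_0$.) Let $\widetilde P_1\in\mathcal B(\mathcal H)$ be any (not necessarily orthogonal) projection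 onto $\ker A(z_0)$ and let $\widetilde Q_1=I-\widetilde P_1$. Then there is a function $\widetilde A_1:\Omega\to\mathcal B(\mathcal H)$ such that $$A(z)=\widetilde A_1(z)\big[\widetilde Q_1-(z-z_0)\widetilde P_1\big],\qquad z\in\Omega,$$ and 1. $\widetilde A_1$ is analytic on $\Omega$; 2. $\widetilde A_1(z)\in\Phi(\mathcal H)$ for all $z\in\Omega$; 3. $\operatorname{def}(\widetilde A_1(z_0))\le\operatorname{def}(A(z_0))$; 4. $\operatorname{ind}(A(z))=\operatorname{ind}(\widetilde A_1(z))=0$ for all $z$ with $|z-z_0|$ sufficiently small; 5. $\widetilde A_1(z)$ is boundedly invertible for all $z\neq z_0$ close to $z_0$, and $\widetilde A_1(\cdot)^{-1}$ has a pole of order $n_0-1$ at $z_0$; for $n_0=1$ this means that $\widetilde A_1(\cdot)^{-1}$ has a removable singularity at $z_0$ with nonzero limit there; 6. for every $z\in\Omega$: $I-A(z)\in\mathcal F(\mathcal H)$ if and only if $I-\widetilde A_1(z)\in\mathcal F(\mathcal H)$; and, for every $p\in[1,\infty]$ and every $z\in\Omega$, $I-A(z)\in\mathcal B_p(\mathcal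 H)$ if and only if $I-\widetilde A_1(z)\in\mathcal B_p(\mathcal H)$. -/

import Mathlib

open Filter Topology

noncomputable section

namespace OperatorFactorization

variable {H : Type*} [NormedAddCommGroup H] [InnerProductSpace ℂ H]

/-- The Fredholm index `dim ker T - dim ker T*` (used for Fredholm operators, where both
dimensions are finite). -/
def index [CompleteSpace H] (T : H →L[ℂ] H) : ℤ :=
  (Module.finrank ℂ T.ker : ℤ)
    - (Module.finrank ℂ (ContinuousLinearMap.adjoint T).ker : ℤ)

/-- The defect `dim (ran T)ᗮ`, as a cardinal, so that no value is assigned by convention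
to an infinite-dimensional complement. -/
def defect (T : H →L[ℂ] H) : Cardinal := Module.rank ℂ (T.range)ᗮ

/-- `P` is a (bounded, not necessarily orthogonal) projection onto the subspace `M`. -/
def IsProjectionOnto (P : H →L[ℂ] H) (M : Submodule ℂ H) : Prop :=
  IsIdempotentElem P ∧ P.range = M

/-- The operator-valued function `z ↦ A(z)⁻¹` has a pole of order `n` at `z₀`: the operator `A(z)`
is boundedly invertible for all `z ≠ z₀` close to `z₀`, and `A(·)⁻¹` is meromorphic at `z₀` (in
operator norm) with leading Laurent term at the exponent `-n`. For `n = 0` this says that `A(·)⁻¹`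
has a removable singularity at `z₀`, with nonzero limit. -/
def InverseHasPoleOfOrder (A : ℂ → H →L[ℂ] H) (z₀ : ℂ) (n : ℕ) : Prop :=
  (∀ᶠ z in 𝓝[≠] z₀, IsUnit (A z)) ∧
    MeromorphicAt (fun z => Ring.inverse (A z)) z₀ ∧
    meromorphicOrderAt (fun z => Ring.inverse (A z)) z₀ = ((-(n : ℤ) : ℤ) : WithTop ℤ)

/-- The `n`-th singular value (counted from `n = 0`, in decreasing order and with multiplicity),
defined as the distance in operator norm from `T` to the operators of rank at most `n`. -/
def singularValue (T : H →L[ℂ] H) (n : ℕ) : ℝ :=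
  sInf {r : ℝ | ∃ F : H →L[ℂ] H, Module.rank ℂ F.range ≤ n ∧ r = ‖T - F‖}

/-- The Schatten--von Neumann ideal with exponent `p`: compact operators whose singular values are
`p`-summable if `p < ∞`; for `p = ∞` all compact operators. -/
def MemSchatten (p : ENNReal) (T : H →L[ℂ] H) : Prop :=
  IsCompactOperator T ∧ (p ≠ ⊤ → Summable fun n : ℕ => singularValue T n ^ p.toReal)

end OperatorFactorization

end

/-!
The factor is explicit: with `D = dslope A z₀`, put `A₁ z = A z * Q - D z * P`. Since
`A z₀ * P = 0`, one has `(z - z₀) • D z * P = A z * P`, and the factorization follows from `P` and `Q` being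
complementary idempotents. Every other property comes from one of three facts.

* `A₁ z = A z - (A z + D z) * P` is a perturbation of `A z` of finite rank, as `ker (A z₀)` is
  finite-dimensional. Such perturbations preserve the Fredholm property
  (`isFredholm_add_hasFiniteRange`), and they shift singular values by finitely many places
  (`singularValue_add_le`), so they preserve the Schatten classes
  (`memSchatten_iff_of_hasFiniteRange_sub`).
* A Fredholm operator that is a norm limit of invertible operators has index zero
  (`index_eq_zero_of_mem_closure_isUnit`). Near `z₀` this applies to `A` and to `A₁`, which are
  both invertible at the points `z ≠ z₀`.
* If `(A z)⁻¹ = (z - z₀) ^ (-n₀) • g z` with `g` analytic and `g z₀ ≠ 0`, then `A z₀ * g z₀ = 0`,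
  that is, `Q * g z₀ = 0`. Hence `Q * g z = (z - z₀) • (Q * h z)` with `h = dslope g z₀`, and
  `(A₁ z)⁻¹ = (Q - (z - z₀) • P) * (A z)⁻¹ = (z - z₀) ^ (1 - n₀) • (Q * h z - P * g z)`. The last
  factor does not vanish at `z₀`, because `P` maps its value there to `-P * g z₀ = -g z₀`
  (`InverseHasPoleOfOrder.of_factorization`).

The defect does not grow because `A z₀ = A₁ z₀ * Q`, so that `ran A z₀ ⊆ ran A₁ z₀`.
-/

open Filter Topology

namespace OperatorFactorization

variable {H : Type*} [NormedAddCommGroup H] [InnerProductSpace ℂ H]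

/-! ### Perturbations of finite rank -/

open scoped LinearMap.FiniteRangeSetoid in
theorem isFredholm_add_hasFiniteRange {T F : H →L[ℂ] H} (hT : T.IsFredholm)
    (hF : (F : H →ₗ[ℂ] H).HasFiniteRange) : (T + F).IsFredholm := by
  obtain ⟨v, hv⟩ := hT.exists_isQuasiInverse
  refine ContinuousLinearMap.IsFredholm.of_isQuasiInverse (v := v) (hv.congr (Setoid.refl _) ?_)
  rw [LinearMap.FiniteRangeSetoid.equiv_iff_hasFiniteRange]
  simpa using hF

theorem isCompactOperator_of_hasFiniteRange {F : H →L[ℂ] H}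
    (hF : (F : H →ₗ[ℂ] H).HasFiniteRange) : IsCompactOperator F := by
  have : FiniteDimensional ℂ F.range := Module.Finite.iff_fg.2 hF
  have : ProperSpace F.range := FiniteDimensional.proper ℂ F.range
  let G : H →L[ℂ] F.range := F.codRestrict F.range fun x => ⟨x, rfl⟩
  exact (isCompactOperator_of_locallyCompactSpace_dom G).clm_comp F.range.subtypeL

theorem singularValue_nonneg (T : H →L[ℂ] H) (n : ℕ) : 0 ≤ singularValue T n :=
  Real.sInf_nonneg (by rintro r ⟨F, -, rfl⟩; exact norm_nonneg _)

/-- Approximating `T` by `G` of rank at most `n` approximates `T + F` by `G + F` of rank at most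
`n + k`, equally well. -/
theorem singularValue_add_le (T F : H →L[ℂ] H) {k : ℕ} (hF : Module.rank ℂ F.range ≤ k) (n : ℕ) :
    singularValue (T + F) (n + k) ≤ singularValue T n := by
  refine le_csInf ⟨‖T - 0‖, 0, by simp, rfl⟩ ?_
  rintro r ⟨G, hG, rfl⟩
  refine csInf_le ⟨0, by rintro r ⟨G, -, rfl⟩; exact norm_nonneg _⟩ ⟨G + F, ?_, by simp⟩
  have h := LinearMap.rank_add_le (G : H →ₗ[ℂ] H) (F : H →ₗ[ℂ] H)
  rw [Nat.cast_add]
  exact h.trans (add_le_add hG hF)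

theorem MemSchatten.add_hasFiniteRange {p : ENNReal} {T F : H →L[ℂ] H} (hT : MemSchatten p T)
    (hF : (F : H →ₗ[ℂ] H).HasFiniteRange) : MemSchatten p (T + F) := by
  refine ⟨hT.1.add (isCompactOperator_of_hasFiniteRange hF), fun hp => ?_⟩
  have : FiniteDimensional ℂ F.range := Module.Finite.iff_fg.2 hF
  -- Summability does not see a shift by the rank of `F`.
  rw [← summable_nat_add_iff (Module.finrank ℂ F.range)]
  refine Summable.of_nonneg_of_le (fun n => Real.rpow_nonneg (singularValue_nonneg _ _) _)
    (fun n => ?_) (hT.2 hp)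
  exact Real.rpow_le_rpow (singularValue_nonneg _ _)
    (singularValue_add_le T F (Module.finrank_eq_rank ℂ F.range).ge n) ENNReal.toReal_nonneg

theorem memSchatten_iff_of_hasFiniteRange_sub {p : ENNReal} {S T : H →L[ℂ] H}
    (h : ((S - T : H →L[ℂ] H) : H →ₗ[ℂ] H).HasFiniteRange) : MemSchatten p S ↔ MemSchatten p T := by
  refine ⟨fun hS => ?_, fun hT => ?_⟩
  · have h' : ((T - S : H →L[ℂ] H) : H →ₗ[ℂ] H).HasFiniteRange := by simpa using h.neg
    simpa using hS.add_hasFiniteRange h'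
  · simpa using hT.add_hasFiniteRange h

theorem hasFiniteRange_iff_of_hasFiniteRange_sub {S T : H →L[ℂ] H}
    (h : ((S - T : H →L[ℂ] H) : H →ₗ[ℂ] H).HasFiniteRange) :
    (S : H →ₗ[ℂ] H).HasFiniteRange ↔ (T : H →ₗ[ℂ] H).HasFiniteRange :=
  ⟨fun hS => by simpa using hS.sub h, fun hT => by simpa using h.add hT⟩

/-! ### Index and defect -/

theorem defect_le_defect_mul (S R : H →L[ℂ] H) : defect S ≤ defect (S * R) := by
  refine Submodule.rank_mono (Submodule.orthogonal_le ?_)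
  rintro _ ⟨x, rfl⟩
  exact ⟨R x, rfl⟩

section Index

variable [CompleteSpace H]

theorem index_eq_zero_of_isUnit {T : H →L[ℂ] H} (hT : IsUnit T) : index T = 0 := by
  have ker_eq_bot : ∀ {S : H →L[ℂ] H}, IsUnit S → S.ker = ⊥ := by
    rintro _ ⟨u, rfl⟩
    refine LinearMap.ker_eq_bot'.2 fun x hx => ?_
    calc x = ((↑u⁻¹ * ↑u : H →L[ℂ] H)) x := by rw [u.inv_mul]; rfl
      _ = (↑u⁻¹ : H →L[ℂ] H) ((↑u : H →L[ℂ] H) x) := rfl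
      _ = 0 := (congrArg (↑u⁻¹ : H →L[ℂ] H) hx).trans (map_zero _)
  have hadj : IsUnit (ContinuousLinearMap.adjoint T) := hT.star
  rw [index, ker_eq_bot hT, ker_eq_bot hadj, sub_self]

/-- The operator `(x, y) ↦ T x + y` from `(ker T)ᗮ × (ran T)ᗮ` to `H` is invertible, and remains so
when `T` is replaced by a nearby `S`. If `S` is itself invertible, then `S (ker T)ᗮ` is
complemented both by `(ran T)ᗮ` and by `S (ker T)`, so these have equal dimension. -/
theorem index_eq_zero_of_mem_closure_isUnit {T : H →L[ℂ] H} (hT : T.IsFredholm)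
    (hcl : T ∈ closure {S : H →L[ℂ] H | IsUnit S}) : index T = 0 := by
  set K : Submodule ℂ H := T.ker with hK
  set N : Submodule ℂ H := (T.range)ᗮ with hN
  have : CompleteSpace T.range := hT.isClosed_range.completeSpace_coe
  have : CompleteSpace K := T.isClosed_ker.completeSpace_coe
  let U : (H →L[ℂ] H) → (Kᗮ × N →L[ℂ] H) := fun S => (S ∘L Kᗮ.subtypeL).coprod N.subtypeL
  have hUc : Continuous U := by
    have : U = fun S => (S ∘L Kᗮ.subtypeL) ∘L ContinuousLinearMap.fst ℂ Kᗮ N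
        + N.subtypeL ∘L ContinuousLinearMap.snd ℂ Kᗮ N := by
      ext S x <;> simp [U]
    rw [this]
    fun_prop
  have hker : (U T).ker = ⊥ := by
    refine LinearMap.ker_eq_bot'.2 ?_
    rintro ⟨x, y⟩ hxy
    have h : T x + y = 0 := by simpa [U] using hxy
    have hy : (y : H) = 0 := by
      refine (Submodule.mem_bot ℂ).1 (T.range.orthogonal_disjoint.le_bot ⟨?_, y.2⟩)
      exact ⟨-x, by simpa using (eq_neg_of_add_eq_zero_right h).symm⟩
    have hx : (x : H) = 0 :=
      (Submodule.mem_bot ℂ).1 (K.orthogonal_disjoint.le_bot ⟨by simpa [hK, hy] using h, x.2⟩)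
    exact Prod.ext (Subtype.ext hx) (Subtype.ext hy)
  have hrange : (U T).range = ⊤ := by
    refine LinearMap.range_eq_top.2 fun w => ?_
    obtain ⟨_, ⟨v, rfl⟩, y, hy, rfl⟩ := T.range.exists_add_mem_mem_orthogonal w
    obtain ⟨k, hk, x, hx, rfl⟩ := K.exists_add_mem_mem_orthogonal v
    have hk0 : T k = 0 := hk
    exact ⟨(⟨x, hx⟩, ⟨y, hy⟩), by simp [U, hk0]⟩
  have hev : ∀ᶠ S in 𝓝 T, U S ∈ Set.range
      ((↑) : ((Kᗮ × N) ≃L[ℂ] H) → (Kᗮ × N →L[ℂ] H)) := by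
    refine hUc.continuousAt.eventually ?_
    have := ContinuousLinearEquiv.nhds (ContinuousLinearEquiv.ofBijective (U T) hker hrange)
    rwa [ContinuousLinearEquiv.coe_ofBijective] at this
  obtain ⟨_, ⟨u, rfl⟩, e, he⟩ := ((mem_closure_iff_frequently.1 hcl).and_eventually hev).exists
  have hu : ∀ x, (↑u : H →L[ℂ] H) ((↑u⁻¹ : H →L[ℂ] H) x) = x := fun x =>
    congrArg (fun f : H →L[ℂ] H => f x) u.mul_inv
  have hu' : ∀ x, (↑u⁻¹ : H →L[ℂ] H) ((↑u : H →L[ℂ] H) x) = x := fun x =>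
    congrArg (fun f : H →L[ℂ] H => f x) u.inv_mul
  have heq : ∀ (x : Kᗮ) (y : N), e (x, y) = (↑u : H →L[ℂ] H) x + y := fun x y => by
    simpa [U] using congrArg (fun f : Kᗮ × N →L[ℂ] H => f (x, y)) he
  -- `u⁻¹ N` and `K` are both complements of `Kᗮ`, so projecting along `Kᗮ` identifies `N` with `K`.
  let f : N →ₗ[ℂ] K :=
    ((K.orthogonalProjectionOnto ∘L (↑u⁻¹ : H →L[ℂ] H)) ∘L N.subtypeL : N →L[ℂ] K)
  have hf : ∀ y : N, f y = K.orthogonalProjectionOnto ((↑u⁻¹ : H →L[ℂ] H) y) := fun _ => rfl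
  have hinj : Function.Injective f := by
    refine LinearMap.ker_eq_bot.1 (LinearMap.ker_eq_bot'.2 fun y hy => ?_)
    rw [hf, Submodule.orthogonalProjectionOnto_eq_zero_iff] at hy
    have h0 : e (⟨_, hy⟩, -y) = 0 := by rw [heq]; simp [hu]
    simpa using congrArg Prod.snd (e.map_eq_zero_iff.1 h0)
  have hsurj : Function.Surjective f := by
    intro k
    obtain ⟨⟨x, y⟩, hxy⟩ := e.surjective ((↑u : H →L[ℂ] H) k)
    rw [heq] at hxy
    have hy : (y : H) = (↑u : H →L[ℂ] H) ((k : H) - x) := by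
      rw [map_sub, ← hxy]; abel
    refine ⟨y, ?_⟩
    rw [hf, hy, hu', map_sub, Submodule.orthogonalProjectionOnto_eq_zero_iff.2 x.2]
    simp
  have hfin := (LinearEquiv.ofBijective f ⟨hinj, hsurj⟩).finrank_eq
  rw [index, ← ContinuousLinearMap.orthogonal_range, ← hK, ← hN, hfin, sub_self]

end Index

/-! ### Splitting off a linear factor -/

section Factor

theorem pencil_mul_pencil {P Q : H →L[ℂ] H} (hP : IsIdempotentElem P) (hQ : Q = 1 - P)
    (c d : ℂ) : (Q - c • P) * (Q - d • P) = Q + (c * d) • P := by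
  have hPP : P * P = P := hP
  subst hQ
  simp only [sub_mul, mul_sub, one_mul, mul_one, smul_mul_assoc, mul_smul_comm, hPP]
  module

theorem isUnit_pencil {P Q : H →L[ℂ] H} (hP : IsIdempotentElem P) (hQ : Q = 1 - P)
    {c : ℂ} (hc : c ≠ 0) : IsUnit (Q - c • P) := by
  refine ⟨⟨Q - c • P, Q - c⁻¹ • P, ?_, ?_⟩, rfl⟩ <;> rw [pencil_mul_pencil hP hQ] <;>
    simp [hc, hQ]

/-- If `A = A₁ * (Q - (z - z₀) P)`, where `P` is a projection onto `ker A(z₀)` and `Q = 1 - P`, then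
the order of the pole of the inverse at `z₀` drops by one. -/
theorem InverseHasPoleOfOrder.of_factorization {A A₁ : ℂ → H →L[ℂ] H} {z₀ : ℂ} {n : ℕ}
    (hn : 1 ≤ n) (hA : ContinuousAt A z₀) (hpole : InverseHasPoleOfOrder A z₀ n)
    {P Q : H →L[ℂ] H} (hP : IsProjectionOnto P (A z₀).ker) (hQ : Q = 1 - P)
    (hfac : ∀ᶠ z in 𝓝 z₀, A z = A₁ z * (Q - (z - z₀) • P)) :
    InverseHasPoleOfOrder A₁ z₀ (n - 1) := by
  obtain ⟨hunit, hmer, hord⟩ := hpole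
  have hPP : P * P = P := hP.1
  have hne : ∀ᶠ z in 𝓝[≠] z₀, z - z₀ ≠ 0 := by
    filter_upwards [self_mem_nhdsWithin] with z hz using sub_ne_zero.2 hz
  have hfac' := hfac.filter_mono (nhdsWithin_le_nhds (s := {z₀}ᶜ))
  have hunit₁ : ∀ᶠ z in 𝓝[≠] z₀, IsUnit (A₁ z) := by
    filter_upwards [hunit, hfac', hne] with z hz hf hz0
    obtain ⟨u, hu⟩ := isUnit_pencil hP.1 hQ hz0
    rwa [hf, ← hu, Units.isUnit_mul_units] at hz
  have hinv : ∀ᶠ z in 𝓝[≠] z₀,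
      Ring.inverse (A₁ z) = (Q - (z - z₀) • P) * Ring.inverse (A z) := by
    filter_upwards [hunit, hunit₁, hfac', hne] with z hz hz₁ hf hz0
    have hR := isUnit_pencil hP.1 hQ hz0
    rw [hf, Ring.inverse_mul (Or.inl hz₁), Ring.mul_inverse_cancel_left _ _ hR]
  obtain ⟨g, hg, hg0, hgz⟩ := (meromorphicOrderAt_eq_int_iff hmer).1 hord
  have hAg : A z₀ * g z₀ = 0 := by
    have h1 : Tendsto (fun z => A z * g z) (𝓝[≠] z₀) (𝓝 (A z₀ * g z₀)) :=
      (hA.mul hg.continuousAt).tendsto.mono_left nhdsWithin_le_nhds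
    have h2 : Tendsto (fun z => ((z - z₀) ^ n) • (1 : H →L[ℂ] H)) (𝓝[≠] z₀) (𝓝 0) := by
      have : Continuous fun z : ℂ => ((z - z₀) ^ n) • (1 : H →L[ℂ] H) := by fun_prop
      have h := (this.tendsto z₀).mono_left (nhdsWithin_le_nhds (s := {z₀}ᶜ))
      simpa [zero_pow (Nat.one_le_iff_ne_zero.1 hn)] using h
    refine tendsto_nhds_unique h1 (h2.congr' ?_)
    filter_upwards [hunit, hgz, hne] with z hz hgz hz0
    have : g z = (z - z₀) ^ n • Ring.inverse (A z) := by
      rw [hgz, smul_smul, zpow_neg, zpow_natCast, mul_inv_cancel₀ (pow_ne_zero _ hz0), one_smul]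
    rw [this, mul_smul_comm, Ring.mul_inverse_cancel _ hz]
  have hPg : P * g z₀ = g z₀ := by
    ext x
    have hx : g z₀ x ∈ P.range := by
      rw [hP.2]
      exact congrArg (fun f : H →L[ℂ] H => f x) hAg
    obtain ⟨y, hy⟩ := hx
    have := congrArg (fun f : H →L[ℂ] H => f y) hPP
    change P (g z₀ x) = g z₀ x
    rw [← hy]
    exact this
  have hQg : Q * g z₀ = 0 := by rw [hQ, sub_mul, one_mul, hPg, sub_self]
  have hh : AnalyticAt ℂ (dslope g z₀) z₀ := by
    obtain ⟨p, hp⟩ := hg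
    exact ⟨_, hp.has_fpower_series_dslope_fslope⟩
  have hk : AnalyticAt ℂ (fun z => Q * dslope g z₀ z - P * g z) z₀ :=
    (analyticAt_const.mul hh).sub (analyticAt_const.mul hg)
  have hk0 : Q * dslope g z₀ z₀ - P * g z₀ ≠ 0 := by
    intro h
    have h' := congrArg (P * ·) h
    have hPQ : P * Q = 0 := by rw [hQ, mul_sub, mul_one, hPP, sub_self]
    simp only [mul_sub, ← mul_assoc, hPQ, hPg, zero_mul, zero_sub, mul_zero] at h'
    exact hg0 (neg_eq_zero.1 h')
  have hkz : ∀ᶠ z in 𝓝[≠] z₀, Ring.inverse (A₁ z) =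
      (z - z₀) ^ (-((n - 1 : ℕ) : ℤ)) • (Q * dslope g z₀ z - P * g z) := by
    filter_upwards [hinv, hgz, hne] with z hi hgz hz0
    have hd : Q * g z = (z - z₀) • (Q * dslope g z₀ z) := by
      rw [← mul_smul_comm, sub_smul_dslope, mul_sub, hQg, sub_zero]
    have hexp : (z - z₀) ^ (-((n - 1 : ℕ) : ℤ)) = (z - z₀) ^ (-(n : ℤ)) * (z - z₀) := by
      rw [← zpow_add_one₀ hz0]
      congr 1
      omega
    rw [hi, hgz, hexp, mul_smul, mul_smul_comm, sub_mul, hd, smul_mul_assoc, ← smul_sub]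
  have hmer₁ : MeromorphicAt (fun z => Ring.inverse (A₁ z)) z₀ := by
    refine MeromorphicAt.congr ?_ (hkz.mono fun z hz => hz.symm)
    exact ((analyticAt_id.sub analyticAt_const).meromorphicAt.zpow _).smul hk.meromorphicAt
  exact ⟨hunit₁, hmer₁, (meromorphicOrderAt_eq_int_iff hmer₁).2 ⟨_, hk, hk0, hkz⟩⟩

end Factor

end OperatorFactorization

open OperatorFactorization in
theorem theorem3p7 {H : Type*} [NormedAddCommGroup H] [InnerProductSpace ℂ H] [CompleteSpace H]
    [TopologicalSpace.SeparableSpace H]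
    (Ω : Set ℂ) (hΩ_open : IsOpen Ω) (hΩ_conn : IsConnected Ω)
    (A : ℂ → H →L[ℂ] H) (hA : AnalyticOnNhd ℂ A Ω)
    (hA_fred : ∀ z ∈ Ω, (A z).IsFredholm)
    (z₀ : ℂ) (hz₀ : z₀ ∈ Ω)
    (n₀ : ℕ) (hn₀ : 1 ≤ n₀) (hpole : OperatorFactorization.InverseHasPoleOfOrder A z₀ n₀)
    (P Q : H →L[ℂ] H)
    (hP : OperatorFactorization.IsProjectionOnto P (A z₀).ker)
    (hQ : Q = 1 - P) :
    ∃ A₁ : ℂ → H →L[ℂ] H,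
      (∀ z ∈ Ω, A z = A₁ z * (Q - (z - z₀) • P)) ∧
      AnalyticOnNhd ℂ A₁ Ω ∧
      (∀ z ∈ Ω, (A₁ z).IsFredholm) ∧
      OperatorFactorization.defect (A₁ z₀) ≤ OperatorFactorization.defect (A z₀) ∧
      (∀ᶠ z in 𝓝 z₀,
        OperatorFactorization.index (A z) = 0 ∧ OperatorFactorization.index (A₁ z) = 0) ∧
      OperatorFactorization.InverseHasPoleOfOrder A₁ z₀ (n₀ - 1) ∧
      (∀ z ∈ Ω, (((1 - A z : H →L[ℂ] H) : H →ₗ[ℂ] H).HasFiniteRange ↔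
        ((1 - A₁ z : H →L[ℂ] H) : H →ₗ[ℂ] H).HasFiniteRange)) ∧
      (∀ p : ENNReal, 1 ≤ p → ∀ z ∈ Ω,
        (OperatorFactorization.MemSchatten p (1 - A z) ↔
          OperatorFactorization.MemSchatten p (1 - A₁ z))) := by
  have hPP : P * P = P := hP.1
  have hQP : Q * P = 0 := by rw [hQ, sub_mul, one_mul, hPP, sub_self]
  have hPQ : P * Q = 0 := by rw [hQ, mul_sub, mul_one, hPP, sub_self]
  have hQQ : Q * Q = Q := by nth_rw 2 [hQ]; rw [mul_sub, mul_one, hQP, sub_zero]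
  have hAP : A z₀ * P = 0 := by
    ext x
    have : P x ∈ (A z₀).ker := hP.2 ▸ ⟨x, rfl⟩
    exact this
  have hPfin : (P : H →ₗ[ℂ] H).HasFiniteRange := by
    have := (hA_fred z₀ hz₀).finite_ker
    rw [LinearMap.hasFiniteRange_iff_range, hP.2]
    exact Module.Finite.iff_fg.1 inferInstance
  set D := dslope A z₀ with hD
  have hDan : AnalyticOnNhd ℂ D Ω :=
    ((Complex.differentiableOn_dslope (hΩ_open.mem_nhds hz₀)).2 hA.differentiableOn).analyticOnNhd
      hΩ_open
  let A₁ : ℂ → H →L[ℂ] H := fun z => A z * Q - D z * P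
  have hA₁an : AnalyticOnNhd ℂ A₁ Ω :=
    (hA.mul analyticOnNhd_const).sub (hDan.mul analyticOnNhd_const)
  have hfac : ∀ z, A z = A₁ z * (Q - (z - z₀) • P) := fun z => by
    have hDP : (z - z₀) • (D z * P) = A z * P := by
      rw [← smul_mul_assoc, sub_smul_dslope, sub_mul, hAP, sub_zero]
    have h : A₁ z * (Q - (z - z₀) • P) = A z * Q + (z - z₀) • (D z * P) := by
      simp only [A₁, sub_mul, mul_sub, mul_smul_comm, mul_assoc, hQQ, hQP, hPQ, hPP]
      simp
    rw [h, hDP, hQ, ← mul_add, sub_add_cancel, mul_one]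
  have hdiff : ∀ z, A₁ z = A z + -((A z + D z) * P) := fun z => by
    simp only [A₁, hQ, mul_sub, mul_one, add_mul]
    abel
  have hfin : ∀ z, ((-((A z + D z) * P) : H →L[ℂ] H) : H →ₗ[ℂ] H).HasFiniteRange := fun z => by
    have := (hPfin.comp_left ((A z + D z : H →L[ℂ] H) : H →ₗ[ℂ] H)).neg
    exact this
  have hfin' : ∀ z, (((1 - A z) - (1 - A₁ z) : H →L[ℂ] H) : H →ₗ[ℂ] H).HasFiniteRange :=
    fun z => by
      rw [sub_sub_sub_cancel_left, hdiff z, add_sub_cancel_left]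
      exact hfin z
  have hA₁fred : ∀ z ∈ Ω, (A₁ z).IsFredholm := fun z hz => by
    rw [hdiff z]
    exact isFredholm_add_hasFiniteRange (hA_fred z hz) (hfin z)
  have hpole₁ : InverseHasPoleOfOrder A₁ z₀ (n₀ - 1) :=
    hpole.of_factorization hn₀ (hA z₀ hz₀).continuousAt hP hQ (Eventually.of_forall hfac)
  have hindex : ∀ B : ℂ → H →L[ℂ] H, ContinuousAt B z₀ → (B z₀).IsFredholm →
      (∀ᶠ z in 𝓝[≠] z₀, IsUnit (B z)) → ∀ᶠ z in 𝓝 z₀, index (B z) = 0 := by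
    intro B hBc hBf hBu
    rw [← nhdsNE_sup_pure, eventually_sup, eventually_pure]
    exact ⟨hBu.mono fun z hz => index_eq_zero_of_isUnit hz,
      index_eq_zero_of_mem_closure_isUnit hBf <|
        mem_closure_of_tendsto (hBc.tendsto.mono_left nhdsWithin_le_nhds) hBu⟩
  refine ⟨A₁, fun z _ => hfac z, hA₁an, hA₁fred, ?_, ?_, hpole₁,
    fun z _ => hasFiniteRange_iff_of_hasFiniteRange_sub (hfin' z),
    fun p _ z _ => memSchatten_iff_of_hasFiniteRange_sub (hfin' z)⟩
  · rw [hfac z₀]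
    exact defect_le_defect_mul _ _
  · exact (hindex A (hA z₀ hz₀).continuousAt (hA_fred z₀ hz₀) hpole.1).and
      (hindex A₁ (hA₁an z₀ hz₀).continuousAt (hA₁fred z₀ hz₀) hpole₁.1)
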